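/- Let $\mathcal G$ be a finite regular (conforming, no hanging nodes) mesh of closed non-degenerate tetrahedra in $\mathbb R^3$ covering $\overline\Omega$, and let $p\in\mathbb N_0$. Let $P_n^{(\alpha,\beta)}(x)=\frac{(\alpha+1)_n}{n!}\sum_{j=0}^n\frac{(-n)_j\,(n+\alpha+\beta+1)_j}{(\alpha+1)_j\,j!}\left(\frac{1-x}{2}\right)^j$ be the Jacobi polynomials. Let $\widehat T$ be the closed triangle with vertices $(0,0),(1,0),(0,1)$ and, for $0\le k\le n$, let $$b_{n,k}(x_1,x_2)=(x_1+x_2)^k\,P_{n-k}^{(0,2k+1)}\bigl(2(x_1+x_2)-1\bigr)\,P_k^{(0,0)}\!\left(\tfrac{x_1-x_2}{x_1+x_2}\right)$$ (a polynomial, extended continuously to $x_1+x_2=0$). With $d_{\mathrm{refl}}(p)=\lfloor (p+2)/3\rfloor$ set, for $0\le k\le d_{\mathrm{refl}}(p)-1$, $$b_{p,k}^{\mathrm{refl}}(x_1,x_2)=\tfrac13\bigl(2b_{p,2k}(x_1,x_2)-b_{p,2k}(x_2,1-x_1-x_2)-b_{p,2k}(1-x_1-x_2,x_1)\bigr).$$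 For $p\ge 1$ let $\mathcal N^p$ be the set of nodal points $\sum_{i=0}^3\frac{\alpha_i}{p}A_i$, where $A_0,\dots,A_3$ are the vertices of a tetrahedron of $\mathcal G$ and $\alpha_i\in\mathbb N_0$, $\sum_i\alpha_i=p$, and let $(B_{p,\mathbf N}^{\mathcal G})_{\mathbf N\in\mathcal N^p}$ be the Lagrange basis of the continuous functions on $\overline\Omega$ that are polynomials of degree at most $p$ on each tetrahedron, i.e. $B_{p,\mathbf N}^{\mathcal G}(\mathbf N')=\delta_{\mathbf N,\mathbf N'}$. Let $T$ be an inner facet of $\mathcal G$, i.e. a triangular facet of the mesh that is not contained in $\partial\Omega$, and let $\omega_T$ be the union of the tetrahedra $K_1,K_2$ adjacent to $T$; let $\mathbf V_i$ be the vertex of $K_i$ opposite to $T$. For $0\le k\le d_{\mathrm{refl}}(p)-1$ let $$B_{p,k}^{T,\mathrm{nc}}=\sum_{\mathbf N\in\mathcal N^p\cap\partial\omega_T}B_{p,k}^{T,\mathrm{nc}}(\mathbf N)\,B_{p,\mathbf N}^{\mathcal G}\quad\text{on }\omega_T,\qquad B_{p,k}^{T,\mathrm{nc}}=0\quad\text{outside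 }\omega_T,$$ where $B_{p,k}^{T,\mathrm{nc}}(\mathbf N)=b_{p,k}^{\mathrm{refl}}(\chi^{-1}(\mathbf N))$ if $\mathbf N$ lies on a facet $\widetilde T\ne T$ of $K_i$ and $\chi:\widehat T\to\widetilde T$ is an affine bijection with $\chi(0,0)=\mathbf V_i$ (by the symmetry of $b_{p,k}^{\mathrm{refl}}$ the value does not depend on the choice of $\widetilde T$ and $\chi$). Let $$S_{T,\mathrm{nc}}^p=\operatorname{span}\bigl\{B_{p,k}^{T,\mathrm{nc}}:0\le k\le d_{\mathrm{refl}}(p)-1\bigr\}$$ (which is $\{0\}$ for $p=0$). Let $\mathbb P_{p,p-1}^{\perp}(\widehat T)$ be the space of polynomials $q$ on $\widehat T$ of total degree at most $p$ with $\int_{\widehat T}qr=0$ for all polynomials $r$ of total degree less than $p$, and let $\mathbb P_{p,p-1}^{\perp}(T)=\{q\circ\chi_T^{-1}:q\in\mathbb P_{p,p-1}^{\perp}(\widehat T)\}$, where $\chi_T:\widehat T\to T$ is an affine bijection. Then, for every $u\in S_{T,\mathrm{nc}}^p$, $$u|_T\in\mathbb P_{p,p-1}^{\perp}(T)\quad\Longrightarrow\quad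 u=0 .$$ -/

import Mathlib

noncomputable section

namespace CrouzeixRaviart

/-- Points of `ℝ³` with the Euclidean norm. -/
abbrev E3 : Type := EuclideanSpace ℝ (Fin 3)

/-! ### Orthogonal polynomials on the reference triangle -/

/-- The Jacobi polynomial `P_n^{(a,b)}`, given by its terminating hypergeometric series
`(a+1)_n / n! * ₂F₁(-n, n+a+b+1; a+1; (1-x)/2)`, where `(c)_j` is the shifted factorial. -/
def jacobi (a b : ℝ) (n : ℕ) (x : ℝ) : ℝ :=
  (ascPochhammer ℝ n).eval (a + 1) / (n.factorial : ℝ) *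
    ∑ j ∈ Finset.range (n + 1),
      (ascPochhammer ℝ j).eval (-(n : ℝ)) * (ascPochhammer ℝ j).eval ((n : ℝ) + a + b + 1) /
        ((ascPochhammer ℝ j).eval (a + 1) * (j.factorial : ℝ)) * ((1 - x) / 2) ^ j

/-- The basis function
`b_{n,k}(x₁,x₂) = (x₁+x₂)^k P_{n-k}^{(0,2k+1)}(2(x₁+x₂)-1) P_k^{(0,0)}((x₁-x₂)/(x₁+x₂))`
(for `k ≤ n`) on the reference triangle. It is used on the closed reference triangle only, where
`x₁ + x₂ = 0` happens just at the origin; there the Lean expression has the right value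
(`(-1)^n (n+1)` for `k = 0`, and `0` for `k ≥ 1`). -/
def bBasis (n k : ℕ) (x₁ x₂ : ℝ) : ℝ :=
  (x₁ + x₂) ^ k * jacobi 0 (2 * (k : ℝ) + 1) (n - k) (2 * (x₁ + x₂) - 1) *
    jacobi 0 0 k ((x₁ - x₂) / (x₁ + x₂))

/-- `d_refl(p) = ⌊(p+2)/3⌋`. -/
def dRefl (p : ℕ) : ℕ := (p + 2) / 3

/-- `b_{p,k}^refl`, the reflection-type orthogonal polynomials on the reference triangle. -/
def bRefl (p k : ℕ) (x₁ x₂ : ℝ) : ℝ :=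
  1 / 3 * (2 * bBasis p (2 * k) x₁ x₂ - bBasis p (2 * k) x₂ (1 - x₁ - x₂)
    - bBasis p (2 * k) (1 - x₁ - x₂) x₁)

/-- The closed unit triangle with vertices `(0,0)`, `(1,0)`, `(0,1)`. -/
def refTriangle : Set (Fin 2 → ℝ) := {x | 0 ≤ x 0 ∧ 0 ≤ x 1 ∧ x 0 + x 1 ≤ 1}

/-- `f`, restricted to the reference triangle, belongs to the space of orthogonal polynomials of
degree `n`: it is a polynomial of total degree at most `n` that is orthogonal in `L²` to all
polynomials of total degree less than `n`. For `n = 0` these are the constants. -/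
def IsOrthPolyRef (n : ℕ) (f : (Fin 2 → ℝ) → ℝ) : Prop :=
  ∃ q : MvPolynomial (Fin 2) ℝ, q.totalDegree ≤ n ∧
    (∀ r : MvPolynomial (Fin 2) ℝ, r.totalDegree < n →
      ∫ x in refTriangle, MvPolynomial.eval x q * MvPolynomial.eval x r = 0) ∧
    ∀ x ∈ refTriangle, f x = MvPolynomial.eval x q

/-- `u`, restricted to the triangle in `ℝ³` with vertex set `T`, is an orthogonal polynomial of
degree `n` on that triangle: its pullback by an affine bijection of the reference triangle onto the
triangle is an orthogonal polynomial on the reference triangle. -/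
def IsOrthPolyOn (n : ℕ) (T : Finset E3) (u : E3 → ℝ) : Prop :=
  ∃ a b c : E3, (T : Set E3) = {a, b, c} ∧
    IsOrthPolyRef n (fun x => u (a + x 0 • (b - a) + x 1 • (c - a)))

/-! ### Meshes -/

/-- A regular finite element mesh (no hanging nodes) in `ℝ³`: a finite simplicial complex in which
every face is a face of a tetrahedron. A simplex is represented by its set of vertices. -/
structure Mesh extends Geometry.SimplicialComplex ℝ E3 where
  finite_faces : faces.Finite
  pure : ∀ s ∈ faces, ∃ K ∈ faces, s ⊆ K ∧ K.card = 4

namespace Mesh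

variable (G : Mesh)

/-- The tetrahedra of the mesh. -/
def tets : Set (Finset E3) := {K | K ∈ G.faces ∧ K.card = 4}

/-- The closed set `Ω̄` that is covered by the mesh. -/
def region : Set E3 := G.toSimplicialComplex.space

/-- The inner facets: the triangles of the mesh that do not lie on the boundary of the domain. -/
def innerFacets : Set (Finset E3) :=
  {T | T ∈ G.faces ∧ T.card = 3 ∧ ¬ convexHull ℝ (T : Set E3) ⊆ frontier G.region}

/-- The tetrahedra adjacent to a facet `T`. -/
def adjacent (T : Finset E3) : Set (Finset E3) := {K | K ∈ G.tets ∧ T ⊆ K}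

/-- `ω_T`, the union of the tetrahedra adjacent to the facet `T`. -/
def patch (T : Finset E3) : Set E3 := ⋃ K ∈ G.adjacent T, convexHull ℝ (K : Set E3)

open scoped Classical in
/-- The set of all vertices of the mesh. -/
def vertexFinset : Finset E3 := G.finite_faces.toFinset.biUnion id

open scoped Classical in
/-- The nodal points of order `p`: the points `∑ v ∈ K, (α v / p) v`, where `K` is a tetrahedron of
the mesh and `α` is a family of natural numbers, indexed by the vertices of `K`, with sum `p`. -/
def nodes (p : ℕ) : Finset E3 :=
  (G.finite_faces.toFinset.filter (fun K => K.card = 4)).biUnion fun K =>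
    (K.finsuppAntidiag p).image fun α => ∑ v ∈ K, ((α v : ℝ) / (p : ℝ)) • v

/-! ### The conforming Lagrange basis -/

/-- `w` is the family of barycentric coordinates of `x` with respect to the mesh. -/
def IsBary (x : E3) (w : E3 → ℝ) : Prop :=
  ∃ s ∈ G.faces, (∀ v ∈ s, 0 ≤ w v) ∧ (∀ v, v ∉ s → w v = 0) ∧ ∑ v ∈ s, w v = 1 ∧
    ∑ v ∈ s, w v • v = x

open scoped Classical in
/-- The barycentric coordinates of the points of the mesh: `x ↦ G.bary x v` is the continuous,
piecewise affine function that is `1` at the vertex `v` and `0` at all other vertices. -/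
def bary (x : E3) : E3 → ℝ := if h : ∃ w, G.IsBary x w then h.choose else 0

theorem exists_isBary {K : Finset E3} (hK : K ∈ G.faces) {x : E3}
    (hx : x ∈ convexHull ℝ (K : Set E3)) :
    ∃ w, G.IsBary x w ∧ ∀ v, v ∉ K → w v = 0 := by
  classical
  obtain ⟨w, h0, h1, h2⟩ := Finset.mem_convexHull'.1 hx
  refine ⟨fun v => if v ∈ K then w v else 0, ⟨K, hK, ?_, ?_, ?_, ?_⟩, ?_⟩
  · intro v hv; simpa [hv] using h0 v hv
  · intro v hv; simp [hv]
  · rw [← h1]; exact Finset.sum_congr rfl fun v hv => by simp [hv]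
  · rw [← h2]; exact Finset.sum_congr rfl fun v hv => by simp [hv]
  · intro v hv; simp [hv]

/-- Barycentric coordinates are unique. -/
theorem IsBary.unique {G : Mesh} {x : E3} {w w' : E3 → ℝ} (h : G.IsBary x w)
    (h' : G.IsBary x w') : w = w' := by
  classical
  have key : ∀ (s t : Finset E3) (w w' : E3 → ℝ), s ∈ G.faces → s ⊆ t → t ∈ G.faces →
      (∀ v, v ∉ s → w v = 0) → (∑ v ∈ s, w v = 1) → (∑ v ∈ s, w v • v = x) →
      (∀ v, v ∉ t → w' v = 0) → (∑ v ∈ t, w' v = 1) → (∑ v ∈ t, w' v • v = x) → w = w' := by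
    intro s t w w' _ hst ht hw0 hw1 hwx hw0' hw1' hwx'
    have e1 : ∑ v ∈ t, w v = 1 := by
      rw [← hw1]; exact (Finset.sum_subset hst fun v _ hv => hw0 v hv).symm
    have e2 : ∑ v ∈ t, w v • v = x := by
      rw [← hwx]
      exact (Finset.sum_subset hst fun v _ hv => by rw [hw0 v hv, zero_smul]).symm
    have := (G.indep ht).eq_of_sum_eq_sum_subtype (w₁ := w) (w₂ := w') (by rw [e1, hw1'])
      (by rw [e2, hwx'])
    funext v
    by_cases hv : v ∈ t
    · exact this v hv
    · rw [hw0' v hv, hw0 v fun hs => hv (hst hs)]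
  obtain ⟨s, hs, hpos, h0, h1, hx⟩ := h
  obtain ⟨t, ht, hpos', h0', h1', hx'⟩ := h'
  have hxs : x ∈ convexHull ℝ (s : Set E3) := Finset.mem_convexHull'.2 ⟨w, hpos, h1, hx⟩
  have hxt : x ∈ convexHull ℝ (t : Set E3) := Finset.mem_convexHull'.2 ⟨w', hpos', h1', hx'⟩
  have hxi := G.inter_subset_convexHull hs ht ⟨hxs, hxt⟩
  rw [← Finset.coe_inter] at hxi
  have hne : (s ∩ t).Nonempty := by
    rw [Finset.nonempty_iff_ne_empty]
    intro he
    rw [he] at hxi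
    simp at hxi
  have hi : s ∩ t ∈ G.faces :=
    G.toSimplicialComplex.down_closed hs Finset.inter_subset_left hne
  obtain ⟨w₀, ⟨r, hr, -, g0, g1, gx⟩, -⟩ := G.exists_isBary hi hxi
  obtain ⟨u, u0, u1, ux⟩ := Finset.mem_convexHull'.1 hxi
  set z : E3 → ℝ := fun v => if v ∈ s ∩ t then u v else 0 with hz
  have z0 : ∀ v, v ∉ s ∩ t → z v = 0 := fun v hv => by simp only [hz, if_neg hv]
  have z1 : ∑ v ∈ s ∩ t, z v = 1 := by
    rw [← u1]; exact Finset.sum_congr rfl fun v hv => by simp only [hz, if_pos hv]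
  have zx : ∑ v ∈ s ∩ t, z v • v = x := by
    rw [← ux]; exact Finset.sum_congr rfl fun v hv => by simp only [hz, if_pos hv]
  exact (key _ s z w hi Finset.inter_subset_left hs z0 z1 zx h0 h1 hx).symm.trans
    (key _ t z w' hi Finset.inter_subset_right ht z0 z1 zx h0' h1' hx')

/-- On the region covered by the mesh, `G.bary x` is the family of barycentric coordinates. -/
theorem bary_eq {x : E3} {w : E3 → ℝ} (h : G.IsBary x w) : G.bary x = w := by
  have hex : ∃ w, G.IsBary x w := ⟨w, h⟩
  rw [bary, dif_pos hex]
  exact hex.choose_spec.unique h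

/-- The function `B_{p,N}` of the conforming Lagrange basis of degree `p` that belongs to the nodal
point `N`. The numbers `p * G.bary N v` are natural numbers with sum `p`; hence, on each
tetrahedron, this is a polynomial of degree at most `p` in the barycentric coordinates. It is `1`
at `N` and `0` at all other nodal points, see `lagrange_node`. -/
def lagrange (p : ℕ) (N x : E3) : ℝ :=
  ∏ v ∈ G.vertexFinset, ∏ j ∈ Finset.range ⌊(p : ℝ) * G.bary N v⌋₊,
    ((p : ℝ) * G.bary x v - (j : ℝ)) / ((p : ℝ) * G.bary N v - (j : ℝ))

theorem bary_of_mem_nodes {p : ℕ} (hp : p ≠ 0) {N : E3} (hN : N ∈ G.nodes p) :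
    ∃ α : E3 →₀ ℕ, α.support ⊆ G.vertexFinset ∧ ∑ v ∈ G.vertexFinset, α v = p ∧
      (∀ v, (p : ℝ) * G.bary N v = α v) ∧ N = ∑ v ∈ G.vertexFinset, ((α v : ℝ) / (p : ℝ)) • v := by
  classical
  simp only [nodes, Finset.mem_biUnion, Finset.mem_filter, Set.Finite.mem_toFinset,
    Finset.mem_image, Finset.mem_finsuppAntidiag] at hN
  obtain ⟨K, ⟨hK, -⟩, α, ⟨hsum, hsup⟩, rfl⟩ := hN
  have hp' : (p : ℝ) ≠ 0 := Nat.cast_ne_zero.2 hp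
  have hα : ∀ v, v ∉ K → α v = 0 := fun v hv => by
    by_contra hne
    exact hv (hsup (Finsupp.mem_support_iff.2 hne))
  have hKV : K ⊆ G.vertexFinset := fun v hv => by
    simp only [vertexFinset, Finset.mem_biUnion, Set.Finite.mem_toFinset, id]
    exact ⟨K, hK, hv⟩
  refine ⟨α, hsup.trans hKV, ?_, ?_, ?_⟩
  · rw [← hsum]
    exact (Finset.sum_subset hKV fun v _ hv => hα v hv).symm
  · intro v
    rw [G.bary_eq (w := fun v => (α v : ℝ) / p) ⟨K, hK, ?_, ?_, ?_, rfl⟩]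
    · field_simp
    · intro v _; positivity
    · intro v hv; simp [hα v hv]
    · rw [← Finset.sum_div, ← Nat.cast_sum, hsum, div_self hp']
  · exact Finset.sum_subset hKV fun v _ hv => by simp [hα v hv]

theorem lagrange_node {p : ℕ} (hp : p ≠ 0) {N N' : E3} (hN : N ∈ G.nodes p)
    (hN' : N' ∈ G.nodes p) [Decidable (N = N')] :
    G.lagrange p N N' = if N = N' then 1 else 0 := by
  classical
  obtain ⟨α, hα, hαs, hαb, hαN⟩ := G.bary_of_mem_nodes hp hN
  obtain ⟨β, hβ, hβs, hβb, hβN⟩ := G.bary_of_mem_nodes hp hN'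
  have hfl : ∀ v, ⌊(p : ℝ) * G.bary N v⌋₊ = α v := fun v => by rw [hαb, Nat.floor_natCast]
  split_ifs with h
  · subst h
    refine Finset.prod_eq_one fun v _ => Finset.prod_eq_one fun j hj => div_self ?_
    rw [hfl, Finset.mem_range] at hj
    rw [hαb, sub_ne_zero]
    exact_mod_cast hj.ne'
  · have hex : ∃ v ∈ G.vertexFinset, β v < α v := by
      by_contra! hle
      have heq := (Finset.sum_eq_sum_iff_of_le hle).1 (hαs.trans hβs.symm)
      exact h (hαN.trans ((Finset.sum_congr rfl fun v hv => by rw [heq v hv]).trans hβN.symm))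
    obtain ⟨v, hv, hlt⟩ := hex
    refine Finset.prod_eq_zero hv (Finset.prod_eq_zero (i := β v) ?_ ?_)
    · rw [hfl, Finset.mem_range]; exact hlt
    · rw [hβb, sub_self, zero_div]

/-! ### The non-conforming facet-oriented space -/

/-- `x = (x₁, x₂)` are the reference coordinates of the point `N` on an outer facet of `ω_T`: there
is a tetrahedron `K` adjacent to `T`, with the vertex `V` opposite to `T`, and a facet of `K` other
than `T`, with the vertices `V`, `P`, `Q`, such that the affine map of the reference triangle onto
this facet with `(0,0) ↦ V`, `(1,0) ↦ P`, `(0,1) ↦ Q` maps `x` to `N`. -/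
def IsOuterCoord (T : Finset E3) (N : E3) (x : ℝ × ℝ) : Prop :=
  ∃ K ∈ G.adjacent T, ∃ V ∈ K, V ∉ T ∧ ∃ P ∈ T, ∃ Q ∈ T, P ≠ Q ∧
    0 ≤ x.1 ∧ 0 ≤ x.2 ∧ x.1 + x.2 ≤ 1 ∧ N = V + x.1 • (P - V) + x.2 • (Q - V)

open scoped Classical in
/-- The value of `B_{p,k}^{T,nc}` at a nodal point `N` of `ω_T`: the lifted polynomial
`b_{p,k}^refl` if `N` lies on an outer facet of `ω_T` (that is, on `∂ω_T`), and `0` otherwise.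
Since `b_{p,k}^refl(x₁,x₂) = b_{p,k}^refl(x₂,x₁)`, the value does not depend on the choice of the
reference coordinates. -/
def nodalValue (p k : ℕ) (T : Finset E3) (N : E3) : ℝ :=
  if h : ∃ x, G.IsOuterCoord T N x then bRefl p k h.choose.1 h.choose.2 else 0

/-- The non-conforming facet-oriented basis function `B_{p,k}^{T,nc}`. It vanishes outside of
`ω_T`. -/
def facetBasis (p k : ℕ) (T : Finset E3) : E3 → ℝ :=
  (G.patch T).indicator fun x => ∑ N ∈ G.nodes p, G.nodalValue p k T N * G.lagrange p N x

/-- The non-conforming facet-oriented space `S_{T,nc}^p`, the span of the functions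
`B_{p,k}^{T,nc}`, `0 ≤ k ≤ d_refl(p) - 1`. -/
def facetSpace (p : ℕ) (T : Finset E3) : Submodule ℝ (E3 → ℝ) :=
  Submodule.span ℝ {f | ∃ k < dRefl p, f = G.facetBasis p k T}

end Mesh

end CrouzeixRaviart

end

/-! Write `u = ∑ c k • G.facetBasis p k T` and `Q = ∑ c k * bRefl p k` on the reference triangle. An
edge of `T` also lies on an outer facet of the patch, so the nodal values of `u` along each edge of
`T` are those of `Q` along `x₁ + x₂ = 1`.

An orthogonal polynomial of degree `p ≥ 1` is determined by its values at the `p + 1` equidistant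
nodes of one edge (`IsOrthPolyRef.eq_zero_of_nodes`): if `q` vanishes on `x₁ = 0`, then `q = x₁ r`
with `deg r < p`, so `0 = ∫ q r = ∫ x₁ r²` and `r = 0`. Both `Q` (`isOrthPolyRef_bRefl`) and the
pullback `g` of `u` are orthogonal polynomials. Comparing them along different edges gives `g = Q`
and `g = Q ∘ refRotation`, so `Q` is invariant under cyclic rotation (`sum_bRefl_eq_zero`).

The three rotations of each `bRefl` sum to zero (`bRefl_add_rotations`). Hence `3 Q = 0`, every
nodal value of `u` vanishes, and `u = 0`. Linear independence of the `bRefl` plays no role.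

The orthogonality of `bBasis` is derived from the series: collapsed coordinates split the integral
into two one-dimensional Jacobi integrals, which vanish because high finite differences kill
polynomials. -/

namespace CrouzeixRaviart

open Finset intervalIntegral

/-! ### Jacobi polynomials: expansion, orthogonality, parity -/

/-- The coefficients of the Jacobi polynomial `P_m^{(0,b)}(1 - 2z)` in the powers of `z`. -/
noncomputable def jacobiCoeff (b m j : ℕ) : ℝ := (-1) ^ j * m.choose j * (m + b + j).choose j

theorem jacobi_zero_eq_sum (b m : ℕ) (x : ℝ) :
    jacobi 0 b m x = ∑ j ∈ range (m + 1), jacobiCoeff b m j * ((1 - x) / 2) ^ j := by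
  have hone : ∀ n : ℕ, (ascPochhammer ℝ n).eval ((0 : ℝ) + 1) = n.factorial := fun n => by
    rw [zero_add, ascPochhammer_eval_one]
  rw [jacobi, hone, div_self (Nat.cast_ne_zero.2 m.factorial_ne_zero), one_mul]
  refine sum_congr rfl fun j _ => ?_
  congr 1
  have hneg : (ascPochhammer ℝ j).eval (-(m : ℝ)) = (-1) ^ j * (m.descFactorial j : ℝ) := by
    rw [ascPochhammer_eval_neg_eq_descPochhammer, descPochhammer_eval_eq_descFactorial]
  have hpos : (ascPochhammer ℝ j).eval ((m : ℝ) + 0 + b + 1) = ((m + b + 1).ascFactorial j : ℝ) := by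
    rw [← ascPochhammer_nat_eq_ascFactorial, ascPochhammer_eval_cast]
    push_cast
    ring_nf
  rw [hneg, hpos, hone, Nat.descFactorial_eq_factorial_mul_choose,
    Nat.ascFactorial_eq_factorial_mul_choose, jacobiCoeff]
  have := Nat.cast_ne_zero (R := ℝ).2 j.factorial_ne_zero
  push_cast
  field_simp

theorem integral_pow_mul_one_sub_pow (a b : ℕ) :
    ∫ s in (0 : ℝ)..1, s ^ a * (1 - s) ^ b =
      a.factorial * b.factorial / (a + b + 1).factorial := by
  induction b generalizing a with
  | zero =>
    have := Nat.cast_ne_zero (R := ℝ).2 a.factorial_ne_zero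
    simp only [pow_zero, mul_one, integral_pow, one_pow, add_zero, Nat.factorial_succ,
      Nat.factorial_zero]
    push_cast
    field_simp
    simp
  | succ b ih =>
    have hd : ∀ s ∈ Set.uIcc (0 : ℝ) 1, HasDerivAt (fun s : ℝ => s ^ (a + 1) * (1 - s) ^ (b + 1))
        ((a + 1) * (s ^ a * (1 - s) ^ (b + 1)) - (b + 1) * (s ^ (a + 1) * (1 - s) ^ b)) s := by
      intro s _
      have h := (hasDerivAt_pow (a + 1) s).mul (((hasDerivAt_id s).const_sub 1).pow (b + 1))
      refine h.congr_deriv ?_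
      simp
      ring
    have h := integral_eq_sub_of_hasDerivAt hd (Continuous.intervalIntegrable (by fun_prop) _ _)
    rw [integral_sub (Continuous.intervalIntegrable (by fun_prop) _ _)
      (Continuous.intervalIntegrable (by fun_prop) _ _), integral_const_mul, integral_const_mul,
      ih] at h
    simp only [one_pow, sub_self, zero_pow (Nat.succ_ne_zero _), mul_zero, zero_mul] at h
    have e : a + 1 + b + 1 = a + (b + 1) + 1 := by ring
    rw [e] at h
    have ha : (a : ℝ) + 1 ≠ 0 := by positivity
    rw [← mul_right_inj' ha, sub_eq_zero.1 h, Nat.factorial_succ a, Nat.factorial_succ b]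
    push_cast
    ring

/-- Up to the sign `(-1)^m`, the sum is the `m`-th forward difference of `P` at `0`. -/
theorem sum_neg_one_pow_mul_choose_mul_eval (m : ℕ) {P : Polynomial ℝ} (hP : P.natDegree < m) :
    ∑ j ∈ range (m + 1), (-1) ^ j * (m.choose j : ℝ) * P.eval (j : ℝ) = 0 := by
  have h := congr_fun (Polynomial.fwdDiff_iter_eq_zero_of_degree_lt hP) 0
  rw [fwdDiff_iter_eq_sum_shift] at h
  have hm : ((-1 : ℝ) ^ m) ≠ 0 := pow_ne_zero _ (by norm_num)
  rw [← mul_right_inj' hm, mul_zero, mul_sum]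
  refine Eq.trans (sum_congr rfl fun j hj => ?_) h
  have hj' : j ≤ m := Nat.lt_succ_iff.1 (mem_range.1 hj)
  obtain ⟨i, rfl⟩ := Nat.exists_eq_add_of_le hj'
  have : (-1 : ℝ) ^ j * (-1) ^ j = 1 := by rw [← mul_pow]; norm_num
  simp only [zsmul_eq_mul, nsmul_eq_mul, mul_one, zero_add, Nat.add_sub_cancel_left]
  push_cast
  rw [pow_add]
  linear_combination ((-1) ^ i * ((j + i).choose j : ℝ) * P.eval (j : ℝ)) * this

/-- Expanding in powers of `1 - s` and using the Beta integral gives an alternating binomial sum. Up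
to a constant its `j`-th weight is `(m+b+j)! / (b+l+j+1)!`, a polynomial in `j` of degree `m - l - 1
< m`, so the sum is an `m`-th difference that vanishes. -/
theorem integral_pow_mul_jacobi_eq_zero (b : ℕ) {m l : ℕ} (h : l < m) :
    ∫ s in (0 : ℝ)..1, s ^ (b + l) * jacobi 0 b m (2 * s - 1) = 0 := by
  obtain ⟨d, rfl⟩ := Nat.exists_eq_add_of_lt h
  set m := l + d + 1 with hm
  have e : ∀ s : ℝ, s ^ (b + l) * jacobi 0 b m (2 * s - 1) =
      ∑ j ∈ range (m + 1), jacobiCoeff b m j * (s ^ (b + l) * (1 - s) ^ j) := fun s => by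
    rw [jacobi_zero_eq_sum, mul_sum]
    refine sum_congr rfl fun j _ => ?_
    ring_nf
  simp_rw [e]
  rw [integral_finsetSum fun j _ => Continuous.intervalIntegrable (by fun_prop) _ _]
  simp_rw [integral_const_mul, integral_pow_mul_one_sub_pow]
  -- With `d = m - l - 1`, `P(j) = (j+b+l+2)⋯(j+b+m)` is that quotient of factorials.
  set P : Polynomial ℝ := (ascPochhammer ℝ d).comp (Polynomial.X + Polynomial.C ((b : ℝ) + l + 2))
  have hP : P.natDegree < m := by
    refine lt_of_le_of_lt Polynomial.natDegree_comp_le ?_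
    rw [Polynomial.natDegree_X_add_C, ascPochhammer_natDegree]
    lia
  have key := sum_neg_one_pow_mul_choose_mul_eval m hP
  rw [← mul_right_inj' (a := ((b + l).factorial : ℝ) / (m + b).factorial)
    (by positivity), mul_zero, mul_sum] at key
  refine Eq.trans (sum_congr rfl fun j _ => ?_) key
  have hPj : P.eval (j : ℝ) = ((b + l + j + 2).ascFactorial d : ℝ) := by
    rw [← ascPochhammer_nat_eq_ascFactorial, ascPochhammer_eval_cast, Polynomial.eval_comp]
    simp only [Polynomial.eval_add, Polynomial.eval_X, Polynomial.eval_C]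
    push_cast
    ring_nf
  have h1 : (b + l + j + 1).factorial * (b + l + j + 2).ascFactorial d = (m + b + j).factorial := by
    rw [Nat.factorial_mul_ascFactorial]
    congr 1
    lia
  have h2 : (m + b + j).choose j * j.factorial * (m + b).factorial = (m + b + j).factorial := by
    have := Nat.choose_mul_factorial_mul_factorial (n := m + b + j) (k := j) (by lia)
    rwa [Nat.add_sub_cancel] at this
  have h3 := h1.trans h2.symm
  rw [hPj, jacobiCoeff]
  have p1 := Nat.cast_ne_zero (R := ℝ).2 (b + l + j + 1).factorial_ne_zero
  have p2 := Nat.cast_ne_zero (R := ℝ).2 (m + b).factorial_ne_zero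
  have h4 : ((b + l + j + 1).factorial : ℝ) * (b + l + j + 2).ascFactorial d =
    (m + b + j).choose j * j.factorial * (m + b).factorial := by exact_mod_cast h3
  field_simp
  linear_combination (-(m.choose j : ℝ)) * h4

theorem jacobi_zero_zero_neg (k : ℕ) (x : ℝ) :
    jacobi 0 0 k (-x) = (-1) ^ k * jacobi 0 0 k x := by
  have h : ∀ x : ℝ, jacobi 0 0 k x =
      Polynomial.aeval ((1 - x) / 2) (Polynomial.shiftedLegendre k) := fun x => by
    have := jacobi_zero_eq_sum 0 k x
    rw [Nat.cast_zero] at this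
    rw [this, Polynomial.shiftedLegendre, map_sum]
    refine sum_congr rfl fun j _ => ?_
    rw [map_mul, map_pow, Polynomial.aeval_X, Polynomial.aeval_C, jacobiCoeff, add_zero,
      Nat.choose_symm_add]
    simp
  rw [h, h, Polynomial.shiftedLegendre_eval_symm]
  ring_nf

end CrouzeixRaviart

/-! ### Integration on the reference triangle and rotation of orthogonal polynomials -/

namespace CrouzeixRaviart

open Finset MeasureTheory

theorem isCompact_refTriangle : IsCompact refTriangle := by
  refine (isCompact_Icc (a := (0 : Fin 2 → ℝ)) (b := 1)).of_isClosed_subset ?_ ?_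
  · exact (isClosed_le continuous_const (continuous_apply 0)).inter
      ((isClosed_le continuous_const (continuous_apply 1)).inter
        (isClosed_le ((continuous_apply 0).add (continuous_apply 1)) continuous_const))
  · rintro x ⟨h0, h1, h2⟩
    constructor <;> intro i <;> fin_cases i <;> simp <;> linarith

theorem integrableOn_refTriangle {f : (Fin 2 → ℝ) → ℝ} (hf : Continuous f) :
    IntegrableOn f refTriangle :=
  hf.continuousOn.integrableOn_compact isCompact_refTriangle

theorem measurePreserving_sumCoord :
    MeasurePreserving (fun z : ℝ × ℝ => ![z.1, z.2 - z.1]) volume volume :=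
  ((volume_preserving_finTwoArrow ℝ).symm).comp (measurePreserving_prod_sub volume volume)

/-- The cyclic permutation of the vertices of the reference triangle. -/
def refRotation (x : Fin 2 → ℝ) : Fin 2 → ℝ := ![x 1, 1 - x 0 - x 1]

theorem refRotation_mem_iff {x : Fin 2 → ℝ} : refRotation x ∈ refTriangle ↔ x ∈ refTriangle := by
  simp only [refTriangle, refRotation, Set.mem_ofPred_eq, Matrix.cons_val_zero, Matrix.cons_val_one]
  constructor <;> rintro ⟨h0, h1, h2⟩ <;> refine ⟨?_, ?_, ?_⟩ <;> linarith

theorem refRotation_refRotation_refRotation (x : Fin 2 → ℝ) :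
    refRotation (refRotation (refRotation x)) = x := by
  ext i
  fin_cases i <;> simp [refRotation]
  ring

theorem measurePreserving_refRotation : MeasurePreserving refRotation volume volume := by
  set M : Matrix (Fin 2) (Fin 2) ℝ := !![0, 1; -1, -1] with hM
  -- The rotation is affine with linear part `M`, so determinant `1` gives preservation of volume.
  have hdet : M.det = 1 := by simp [hM, Matrix.det_fin_two]
  have h1 : MeasurePreserving (Matrix.toLin' M) volume volume := by
    refine ⟨(LinearMap.continuous_of_finiteDimensional _).measurable, ?_⟩
    rw [Real.map_matrix_volume_pi_eq_smul_volume_pi (by rw [hdet]; exact one_ne_zero), hdet]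
    simp
  have h2 := (measurePreserving_add_right (volume : Measure (Fin 2 → ℝ)) ![0, 1]).comp h1
  convert h2 using 1
  ext x i
  fin_cases i <;> simp [refRotation, hM, dotProduct, Fin.sum_univ_two]
  ring

theorem setIntegral_comp_refRotation {f : (Fin 2 → ℝ) → ℝ} (hf : Continuous f) :
    ∫ x in refTriangle, f (refRotation x) = ∫ x in refTriangle, f x := by
  have hm := isCompact_refTriangle.measurableSet
  rw [← integral_indicator hm, ← integral_indicator hm]
  conv_rhs => rw [← measurePreserving_refRotation.map_eq]
  rw [integral_map measurePreserving_refRotation.measurable.aemeasurable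
    (hf.aestronglyMeasurable.indicator hm)]
  refine integral_congr_ae (Filter.Eventually.of_forall fun x => ?_)
  by_cases hx : x ∈ refTriangle
  · simp only [Set.indicator_of_mem hx, Set.indicator_of_mem (refRotation_mem_iff.2 hx)]
  · simp only [Set.indicator_of_notMem hx, Set.indicator_of_notMem (mt refRotation_mem_iff.1 hx)]

/-- Collapsed coordinates with Jacobian `s`, in two moves: a shear makes `s = x₁ + x₂` a coordinate,
and after Fubini the inner interval `[0, s]` is rescaled to `[0, 1]`. -/
theorem setIntegral_refTriangle_eq {f : (Fin 2 → ℝ) → ℝ} (hf : Continuous f) :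
    ∫ x in refTriangle, f x = ∫ s in (0 : ℝ)..1, s * ∫ t in (0 : ℝ)..1, f ![s * t, s * (1 - t)] := by
  have hm := isCompact_refTriangle.measurableSet
  have hmeas : AEStronglyMeasurable (refTriangle.indicator f) volume :=
    hf.aestronglyMeasurable.indicator hm
  have hint : Integrable (refTriangle.indicator f) volume :=
    (integrableOn_refTriangle hf).integrable_indicator hm
  rw [← integral_indicator hm]
  conv_lhs => rw [← measurePreserving_sumCoord.map_eq]
  rw [integral_map measurePreserving_sumCoord.measurable.aemeasurable
    (by rwa [measurePreserving_sumCoord.map_eq])]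
  have hint' := (measurePreserving_sumCoord.integrable_comp hmeas).2 hint
  rw [Measure.volume_eq_prod] at hint' ⊢
  refine (integral_prod_symm _ hint').trans ?_
  simp only [Function.comp_apply]
  rw [intervalIntegral.integral_of_le zero_le_one, ← integral_Icc_eq_integral_Ioc,
    ← integral_indicator measurableSet_Icc]
  refine integral_congr_ae (Filter.Eventually.of_forall fun s => ?_)
  have hmem : ∀ x : ℝ, ![x, s - x] ∈ refTriangle ↔ s ∈ Set.Icc (0 : ℝ) 1 ∧ x ∈ Set.Icc 0 s := by
    intro x
    simp only [refTriangle, Set.mem_ofPred_eq, Matrix.cons_val_zero, Matrix.cons_val_one,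
      Set.mem_Icc]
    constructor
    · rintro ⟨h0, h1, h2⟩
      refine ⟨⟨?_, ?_⟩, ?_, ?_⟩ <;> linarith
    · rintro ⟨⟨h0, h1⟩, h2, h3⟩
      refine ⟨?_, ?_, ?_⟩ <;> linarith
  by_cases hs : s ∈ Set.Icc (0 : ℝ) 1
  · have e : (fun x : ℝ => refTriangle.indicator f ![x, s - x]) =
        (Set.Icc 0 s).indicator fun x => f ![x, s - x] := by
      funext x
      simp only [Set.indicator, hmem, hs, true_and]
    simp only [Set.indicator_of_mem hs]
    rw [e, integral_indicator measurableSet_Icc, integral_Icc_eq_integral_Ioc,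
      ← intervalIntegral.integral_of_le hs.1]
    -- With the factor `s` kept outside the integral, the rescaling holds for `s = 0` too.
    have h := intervalIntegral.mul_integral_comp_mul_left (a := 0) (b := 1) (f := fun x : ℝ => f ![x, s - x]) s
    rw [mul_zero, mul_one] at h
    rw [← h]
    simp only [mul_sub, mul_one]
  · simp only [Set.indicator_of_notMem hs]
    refine integral_eq_zero_of_ae (Filter.Eventually.of_forall fun x => ?_)
    exact Set.indicator_of_notMem (fun h => hs ((hmem x).1 h).1) _

theorem continuous_mvPolynomial_eval (q : MvPolynomial (Fin 2) ℝ) :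
    Continuous fun x => MvPolynomial.eval x q :=
  MvPolynomial.continuous_eval q

namespace IsOrthPolyRef

variable {n : ℕ} {f g : (Fin 2 → ℝ) → ℝ}

theorem congr (hf : IsOrthPolyRef n f) (h : ∀ x ∈ refTriangle, g x = f x) :
    IsOrthPolyRef n g := by
  obtain ⟨q, hq, ho, hfq⟩ := hf
  exact ⟨q, hq, ho, fun x hx => (h x hx).trans (hfq x hx)⟩

theorem zero (n : ℕ) : IsOrthPolyRef n fun _ => 0 :=
  ⟨0, by simp, by simp, by simp⟩

theorem add (hf : IsOrthPolyRef n f) (hg : IsOrthPolyRef n g) :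
    IsOrthPolyRef n fun x => f x + g x := by
  obtain ⟨q, hq, ho, hfq⟩ := hf
  obtain ⟨q', hq', ho', hfq'⟩ := hg
  refine ⟨q + q', (MvPolynomial.totalDegree_add _ _).trans (max_le hq hq'), fun r hr => ?_,
    fun x hx => by simp [hfq x hx, hfq' x hx]⟩
  simp_rw [map_add, add_mul]
  rw [integral_add, ho r hr, ho' r hr, add_zero] <;>
  exact integrableOn_refTriangle
    ((continuous_mvPolynomial_eval _).mul (continuous_mvPolynomial_eval _))

theorem const_mul (hf : IsOrthPolyRef n f) (c : ℝ) : IsOrthPolyRef n fun x => c * f x := by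
  obtain ⟨q, hq, ho, hfq⟩ := hf
  refine ⟨MvPolynomial.C c * q, ?_, fun r hr => ?_, fun x hx => by simp [hfq x hx]⟩
  · refine (MvPolynomial.totalDegree_mul _ _).trans ?_
    simpa using hq
  · simp_rw [map_mul, MvPolynomial.eval_C, mul_assoc]
    rw [integral_const_mul, ho r hr, mul_zero]

theorem sub (hf : IsOrthPolyRef n f) (hg : IsOrthPolyRef n g) :
    IsOrthPolyRef n fun x => f x - g x :=
  (hf.add (hg.const_mul (-1))).congr fun x _ => by ring

theorem sum {ι : Type*} (s : Finset ι) {f : ι → (Fin 2 → ℝ) → ℝ}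
    (hf : ∀ i ∈ s, IsOrthPolyRef n (f i)) : IsOrthPolyRef n fun x => ∑ i ∈ s, f i x := by
  classical
  induction s using Finset.induction_on with
  | empty => simpa using zero n
  | insert a s ha ih =>
    simp only [Finset.sum_insert ha]
    exact (hf a (Finset.mem_insert_self a s)).add
      (ih fun i hi => hf i (Finset.mem_insert_of_mem hi))

end IsOrthPolyRef

/-- The substitution of the cyclic permutation of the vertices into a polynomial. -/
noncomputable def rotatePoly (q : MvPolynomial (Fin 2) ℝ) : MvPolynomial (Fin 2) ℝ :=
  MvPolynomial.aeval ![MvPolynomial.X 1, 1 - MvPolynomial.X 0 - MvPolynomial.X 1] q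

theorem eval_rotatePoly (q : MvPolynomial (Fin 2) ℝ) (x : Fin 2 → ℝ) :
    MvPolynomial.eval x (rotatePoly q) = MvPolynomial.eval (refRotation x) q := by
  rw [rotatePoly, MvPolynomial.aeval_def, MvPolynomial.algebraMap_eq, MvPolynomial.eval_eval₂,
    MvPolynomial.eval_eq', MvPolynomial.eval₂_eq']
  refine sum_congr rfl fun d _ => ?_
  simp [refRotation, Fin.prod_univ_two]

theorem totalDegree_aeval_le {σ τ : Type*} {f : σ → MvPolynomial τ ℝ}
    (hf : ∀ i, (f i).totalDegree ≤ 1) (q : MvPolynomial σ ℝ) :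
    (MvPolynomial.aeval f q).totalDegree ≤ q.totalDegree := by
  rw [MvPolynomial.aeval_def, MvPolynomial.eval₂]
  refine MvPolynomial.totalDegree_finsetSum_le fun d hd => ?_
  refine (MvPolynomial.totalDegree_mul _ _).trans ?_
  rw [MvPolynomial.algebraMap_eq, MvPolynomial.totalDegree_C, zero_add]
  refine (MvPolynomial.totalDegree_finsetProd _ _).trans (le_trans ?_ (MvPolynomial.le_totalDegree hd))
  refine sum_le_sum fun i _ => (MvPolynomial.totalDegree_pow _ _).trans ?_
  simpa using Nat.mul_le_mul_left (d i) (hf i)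

theorem totalDegree_one_sub_X_sub_X_le :
    (1 - MvPolynomial.X 0 - MvPolynomial.X 1 : MvPolynomial (Fin 2) ℝ).totalDegree ≤ 1 := by
  refine (MvPolynomial.totalDegree_sub _ _).trans (max_le
    ((MvPolynomial.totalDegree_sub _ _).trans (max_le ?_ ?_)) ?_) <;>
  simp [MvPolynomial.totalDegree_X]

theorem totalDegree_rotatePoly_le (q : MvPolynomial (Fin 2) ℝ) :
    (rotatePoly q).totalDegree ≤ q.totalDegree := by
  refine totalDegree_aeval_le (fun i => ?_) q
  fin_cases i
  · simp [MvPolynomial.totalDegree_X]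
  · exact totalDegree_one_sub_X_sub_X_le

theorem IsOrthPolyRef.comp_refRotation {n : ℕ} {f : (Fin 2 → ℝ) → ℝ} (hf : IsOrthPolyRef n f) :
    IsOrthPolyRef n fun x => f (refRotation x) := by
  obtain ⟨q, hq, ho, hfq⟩ := hf
  refine ⟨rotatePoly q, (totalDegree_rotatePoly_le q).trans hq, fun r hr => ?_, fun x hx => ?_⟩
  -- The test polynomial is `r` composed with the inverse rotation, which is the rotation squared;
  -- the change of variables then restores `r`.
  · have h := ho (rotatePoly (rotatePoly r))
      (((totalDegree_rotatePoly_le _).trans (totalDegree_rotatePoly_le _)).trans_lt hr)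
    rw [← setIntegral_comp_refRotation (f := fun x => MvPolynomial.eval x q * _)
      ((continuous_mvPolynomial_eval _).mul (continuous_mvPolynomial_eval _))] at h
    simpa only [eval_rotatePoly, refRotation_refRotation_refRotation] using h
  · simpa only [eval_rotatePoly] using hfq _ (refRotation_mem_iff.2 hx)

end CrouzeixRaviart

/-! ### Orthogonal polynomials are determined by one edge -/

namespace CrouzeixRaviart

open Finset MeasureTheory

/-- The remainder modulo `X 0` contains no `X 0`, so it equals its own restriction to `x 0 = 0`,
where it agrees with `q`. -/
theorem eval_divMonomial_add_modMonomial (q : MvPolynomial (Fin 2) ℝ) (x : Fin 2 → ℝ) :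
    MvPolynomial.eval x q =
      x 0 * MvPolynomial.eval x (q.divMonomial (Finsupp.single 0 1)) +
        MvPolynomial.eval ![0, x 1] q := by
  have hm : ∀ y : Fin 2 → ℝ, MvPolynomial.eval y (q.modMonomial (Finsupp.single 0 1)) =
      MvPolynomial.eval ![0, y 1] (q.modMonomial (Finsupp.single 0 1)) := by
    intro y
    rw [MvPolynomial.eval_eq', MvPolynomial.eval_eq']
    refine sum_congr rfl fun d hd => ?_
    have hd0 : d 0 = 0 := by
      by_contra h
      refine MvPolynomial.mem_support_iff.1 hd (MvPolynomial.coeff_modMonomial_of_le _ ?_)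
      rw [Finsupp.single_le_iff]
      lia
    simp [Fin.prod_univ_two, hd0]
  have h := MvPolynomial.divMonomial_add_modMonomial_single q 0
  have e := fun y : Fin 2 → ℝ => congrArg (MvPolynomial.eval y) h
  simp only [map_add, map_mul, MvPolynomial.eval_X] at e
  have e0 := e ![0, x 1]
  simp only [Matrix.cons_val_zero, zero_mul, zero_add] at e0
  rw [← e x, hm x, e0]

theorem totalDegree_divMonomial_single_lt {σ : Type*} {q : MvPolynomial σ ℝ} {n : ℕ} (hn : n ≠ 0)
    (hq : q.totalDegree ≤ n) (i : σ) :
    (q.divMonomial (Finsupp.single i 1)).totalDegree < n := by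
  rw [MvPolynomial.totalDegree, Finset.sup_lt_iff (Nat.pos_of_ne_zero hn)]
  intro d hd
  rw [MvPolynomial.mem_support_iff, MvPolynomial.coeff_divMonomial,
    ← MvPolynomial.mem_support_iff] at hd
  have h := (MvPolynomial.le_totalDegree hd).trans hq
  rw [Finsupp.sum_add_index' (fun _ => rfl) fun _ _ _ => rfl, Finsupp.sum_single_index rfl] at h
  lia

/-- This upgrades a continuous function that is zero almost everywhere on the triangle to one that
is zero at every point, boundary included. -/
theorem refTriangle_subset_closure_interior : refTriangle ⊆ closure (interior refTriangle) := by
  have hconv : Convex ℝ refTriangle := by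
    rintro x ⟨h0, h1, h2⟩ y ⟨g0, g1, g2⟩ a b ha hb hab
    refine ⟨?_, ?_, ?_⟩ <;> simp only [Pi.add_apply, Pi.smul_apply, smul_eq_mul]
    · positivity
    · positivity
    · nlinarith
  have hne : (interior refTriangle).Nonempty := by
    refine ⟨![1 / 4, 1 / 4], mem_interior.2
      ⟨{x | 0 < x 0 ∧ 0 < x 1 ∧ x 0 + x 1 < 1}, fun x hx => ⟨hx.1.le, hx.2.1.le, hx.2.2.le⟩, ?_, ?_⟩⟩
    · exact (isOpen_lt continuous_const (continuous_apply 0)).inter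
        ((isOpen_lt continuous_const (continuous_apply 1)).inter
          (isOpen_lt ((continuous_apply 0).add (continuous_apply 1)) continuous_const))
    · refine ⟨?_, ?_, ?_⟩ <;> norm_num
  rw [hconv.closure_interior_eq_closure_of_nonempty_interior hne]
  exact subset_closure

namespace IsOrthPolyRef

variable {n : ℕ} {f : (Fin 2 → ℝ) → ℝ}

/-- An orthogonal polynomial of degree `n ≠ 0` on the reference triangle that vanishes at `n + 1`
equidistant points of the edge `x₁ = 0` is zero. -/
theorem eq_zero_of_nodes (hf : IsOrthPolyRef n f) (hn : n ≠ 0)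
    (h : ∀ j ≤ n, f ![0, (j : ℝ) / n] = 0) : ∀ x ∈ refTriangle, f x = 0 := by
  obtain ⟨q, hq, ho, hfq⟩ := hf
  have hn' : (0 : ℝ) < n := by exact_mod_cast Nat.pos_of_ne_zero hn
  have hedge : ∀ y : ℝ, MvPolynomial.eval ![0, y] q = 0 := by
    set P : Polynomial ℝ := MvPolynomial.aeval ![0, Polynomial.X] q
    have hP : ∀ y, P.eval y = MvPolynomial.eval ![0, y] q := fun y => by
      rw [← Polynomial.coe_evalRingHom, show P = MvPolynomial.aeval ![0, Polynomial.X] q from rfl,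
        MvPolynomial.aeval_def, MvPolynomial.eval₂_eq', map_sum,
        MvPolynomial.eval_eq']
      refine sum_congr rfl fun d _ => ?_
      simp [Fin.prod_univ_two]
    have hdeg : P.natDegree ≤ n := by
      refine (MvPolynomial.aeval_natDegree_le (n := 1) q hq _ fun i => ?_).trans_eq (mul_one n)
      fin_cases i <;> simp
    have hzero : P = 0 := by
      refine Polynomial.eq_zero_of_natDegree_lt_card_of_eval_eq_zero P
        (f := fun j : Fin (n + 1) => (j : ℝ) / n) ?_ (fun j => ?_) (by simpa using hdeg)
      · intro i j hij
        have := (div_left_inj' hn'.ne').1 hij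
        exact Fin.ext (by exact_mod_cast this)
      · have hj : (j : ℕ) ≤ n := Nat.lt_succ_iff.1 j.2
        rw [hP, ← hfq, h _ hj]
        refine ⟨?_, ?_, ?_⟩
        · simp
        · simp only [Matrix.cons_val_one, Matrix.cons_val_zero]; positivity
        · simp only [Matrix.cons_val_one, Matrix.cons_val_zero, zero_add]
          rw [div_le_one hn']
          exact_mod_cast hj
    intro y
    rw [← hP, hzero, Polynomial.eval_zero]
  -- Since `q` vanishes on the edge, `q = x 0 * r`. The degree of `r` is below `n`, so `r` is an
  -- admissible test polynomial and the integrand becomes `x 0 * r ^ 2 ≥ 0`.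
  set r := q.divMonomial (Finsupp.single 0 1)
  have hqr : ∀ x, MvPolynomial.eval x q = x 0 * MvPolynomial.eval x r := fun x => by
    rw [eval_divMonomial_add_modMonomial, hedge, add_zero]
  have hint := ho r (totalDegree_divMonomial_single_lt hn hq 0)
  simp_rw [hqr] at hint
  have hcont : Continuous fun x : Fin 2 → ℝ =>
      x 0 * MvPolynomial.eval x r * MvPolynomial.eval x r :=
    ((continuous_apply 0).mul (continuous_mvPolynomial_eval r)).mul
      (continuous_mvPolynomial_eval r)
  have hnonneg : ∀ᵐ x ∂volume.restrict refTriangle,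
      0 ≤ x 0 * MvPolynomial.eval x r * MvPolynomial.eval x r := by
    refine (ae_restrict_iff' isCompact_refTriangle.measurableSet).2
      (Filter.Eventually.of_forall fun x hx => ?_)
    rw [mul_assoc]
    exact mul_nonneg hx.1 (mul_self_nonneg _)
  have hae := (integral_eq_zero_iff_of_nonneg_ae hnonneg (integrableOn_refTriangle hcont)).1 hint
  have heq := Measure.eqOn_of_ae_eq hae hcont.continuousOn continuousOn_const
    refTriangle_subset_closure_interior
  intro x hx
  rw [hfq x hx, hqr]
  have hx' : x 0 * MvPolynomial.eval x r * MvPolynomial.eval x r = 0 := heq hx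
  rcases mul_eq_zero.1 hx' with h' | h'
  · exact h'
  · rw [h', mul_zero]

end IsOrthPolyRef

/-! ### Orthogonality and symmetries of `bBasis` and `bRefl` -/

/-- The polynomial `(x₁ + x₂)^k P_k^{(0,0)}((x₁ - x₂) / (x₁ + x₂))`. -/
noncomputable def homogLegendre (k : ℕ) : MvPolynomial (Fin 2) ℝ :=
  ∑ j ∈ range (k + 1), MvPolynomial.C (jacobiCoeff 0 k j) *
    (MvPolynomial.X 1 ^ j * (MvPolynomial.X 0 + MvPolynomial.X 1) ^ (k - j))

/-- The polynomial `P_m^{(0,b)}(2 (x₁ + x₂) - 1)`. -/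
noncomputable def sumJacobi (b m : ℕ) : MvPolynomial (Fin 2) ℝ :=
  ∑ j ∈ range (m + 1), MvPolynomial.C (jacobiCoeff b m j) *
    (1 - MvPolynomial.X 0 - MvPolynomial.X 1) ^ j

theorem eval_sumJacobi (b m : ℕ) (x : Fin 2 → ℝ) :
    MvPolynomial.eval x (sumJacobi b m) = jacobi 0 b m (2 * (x 0 + x 1) - 1) := by
  rw [jacobi_zero_eq_sum, sumJacobi, map_sum]
  refine sum_congr rfl fun j _ => ?_
  simp only [map_mul, map_pow, map_sub, MvPolynomial.eval_C, MvPolynomial.eval_X, map_one]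
  ring_nf

theorem totalDegree_sumJacobi_le (b m : ℕ) : (sumJacobi b m).totalDegree ≤ m := by
  refine MvPolynomial.totalDegree_finsetSum_le fun j hj => ?_
  refine (MvPolynomial.totalDegree_mul _ _).trans ?_
  rw [MvPolynomial.totalDegree_C, zero_add]
  refine (MvPolynomial.totalDegree_pow _ _).trans
    ((Nat.mul_le_mul_left j totalDegree_one_sub_X_sub_X_le).trans ?_)
  have := mem_range.1 hj
  lia

theorem totalDegree_homogLegendre_le (k : ℕ) : (homogLegendre k).totalDegree ≤ k := by
  refine MvPolynomial.totalDegree_finsetSum_le fun j hj => ?_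
  refine (MvPolynomial.totalDegree_mul _ _).trans ?_
  rw [MvPolynomial.totalDegree_C, zero_add]
  refine (MvPolynomial.totalDegree_mul _ _).trans ?_
  rw [MvPolynomial.totalDegree_X_pow]
  have h1 : (MvPolynomial.X 0 + MvPolynomial.X 1 : MvPolynomial (Fin 2) ℝ).totalDegree ≤ 1 :=
    (MvPolynomial.totalDegree_add _ _).trans (by simp [MvPolynomial.totalDegree_X])
  have h2 := (MvPolynomial.totalDegree_pow (MvPolynomial.X 0 + MvPolynomial.X 1 :
    MvPolynomial (Fin 2) ℝ) (k - j)).trans (Nat.mul_le_mul_left (k - j) h1)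
  have := mem_range.1 hj
  lia

theorem eval_homogLegendre_cone (k : ℕ) (s t : ℝ) :
    MvPolynomial.eval ![s * t, s * (1 - t)] (homogLegendre k) =
      s ^ k * jacobi 0 0 k (2 * t - 1) := by
  have := jacobi_zero_eq_sum 0 k (2 * t - 1)
  rw [Nat.cast_zero] at this
  rw [this, homogLegendre, map_sum, mul_sum]
  refine sum_congr rfl fun j hj => ?_
  obtain ⟨i, rfl⟩ := Nat.exists_eq_add_of_le (Nat.lt_succ_iff.1 (mem_range.1 hj))
  simp only [map_mul, map_pow, map_add, MvPolynomial.eval_C, MvPolynomial.eval_X,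
    Matrix.cons_val_zero, Matrix.cons_val_one, Nat.add_sub_cancel_left, pow_add, mul_pow]
  ring_nf

theorem bBasis_eq_eval (n k : ℕ) {x : Fin 2 → ℝ} (hx : x ∈ refTriangle) :
    bBasis n k (x 0) (x 1) =
      MvPolynomial.eval x (homogLegendre k * sumJacobi (2 * k + 1) (n - k)) := by
  have hL : MvPolynomial.eval x (homogLegendre k) =
      (x 0 + x 1) ^ k * jacobi 0 0 k ((x 0 - x 1) / (x 0 + x 1)) := by
    obtain ⟨h0, h1, h2⟩ := hx
    by_cases hs : x 0 + x 1 = 0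
    -- At the origin Lean's `0 / 0 = 0` is harmless: `P_0` is constant, and for `k ≥ 1` the factor
    -- `(x 0 + x 1) ^ k` vanishes.
    · have e0 : x 0 = 0 := by linarith
      have e1 : x 1 = 0 := by linarith
      have hx0 : x = ![0 * 1, 0 * (1 - 1)] := by
        ext i
        fin_cases i <;> simp [e0, e1]
      rw [hs]
      rw [hx0, eval_homogLegendre_cone]
      rcases Nat.eq_zero_or_pos k with rfl | hk
      · simp [jacobi]
      · rw [zero_pow hk.ne', zero_mul, zero_mul]
    · have hx0 : x = ![(x 0 + x 1) * (x 0 / (x 0 + x 1)), (x 0 + x 1) * (1 - x 0 / (x 0 + x 1))] := by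
        ext i
        fin_cases i
        · simp only [Fin.zero_eta, Matrix.cons_val_zero]; field_simp
        · simp only [Fin.mk_one, Matrix.cons_val_one, Matrix.cons_val_zero]; field_simp; ring
      conv_lhs => rw [hx0]
      rw [eval_homogLegendre_cone]
      congr 2
      field_simp
      ring
  rw [map_mul, hL, eval_sumJacobi, bBasis]
  push_cast
  ring

theorem integral_pow_mul_jacobi_mul_eval_eq_zero (b : ℕ) {m : ℕ} {P : Polynomial ℝ}
    (hP : P.natDegree < m) :
    ∫ s in (0 : ℝ)..1, s ^ b * jacobi 0 b m (2 * s - 1) * P.eval s = 0 := by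
  have hc : Continuous fun s : ℝ => jacobi 0 b m (2 * s - 1) := by
    simp_rw [jacobi_zero_eq_sum]
    fun_prop
  have e : ∀ s : ℝ, s ^ b * jacobi 0 b m (2 * s - 1) * P.eval s =
      ∑ l ∈ range m, P.coeff l * (s ^ (b + l) * jacobi 0 b m (2 * s - 1)) := fun s => by
    rw [Polynomial.eval_eq_sum_range' hP, mul_sum]
    refine sum_congr rfl fun l _ => ?_
    ring
  simp_rw [e]
  rw [intervalIntegral.integral_finsetSum fun l _ =>
    Continuous.intervalIntegrable (by fun_prop) _ _]
  refine sum_eq_zero fun l hl => ?_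
  rw [intervalIntegral.integral_const_mul, integral_pow_mul_jacobi_eq_zero b (mem_range.1 hl),
    mul_zero]

/-- In collapsed coordinates the integral against a monomial of degree `i + j` factors. The
`t`-factor vanishes for `i + j < k` by Legendre orthogonality. Otherwise the `s`-factor vanishes:
the powers of `s`, Jacobian included, supply the weight `s ^ (2k+1)` and a surplus `s ^ l` with `l =
i + j - k < n - k`. -/
theorem isOrthPolyRef_bBasis {n k : ℕ} (hk : k ≤ n) :
    IsOrthPolyRef n fun x => bBasis n k (x 0) (x 1) := by
  refine ⟨homogLegendre k * sumJacobi (2 * k + 1) (n - k), ?_, fun r hr => ?_,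
    fun x hx => bBasis_eq_eval n k hx⟩
  · refine (MvPolynomial.totalDegree_mul _ _).trans ?_
    have h1 := totalDegree_homogLegendre_le k
    have h2 := totalDegree_sumJacobi_le (2 * k + 1) (n - k)
    lia
  have hmono : ∀ i j : ℕ, i + j < n → ∫ x in refTriangle,
      MvPolynomial.eval x (homogLegendre k * sumJacobi (2 * k + 1) (n - k)) *
        (x 0 ^ i * x 1 ^ j) = 0 := by
    intro i j hij
    rw [setIntegral_refTriangle_eq (f := fun x => MvPolynomial.eval x _ * (x 0 ^ i * x 1 ^ j))
      ((continuous_mvPolynomial_eval _).mul (by fun_prop))]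
    have e : ∀ s : ℝ, (s * ∫ t in (0 : ℝ)..1,
        MvPolynomial.eval ![s * t, s * (1 - t)] (homogLegendre k * sumJacobi (2 * k + 1) (n - k)) *
          (![s * t, s * (1 - t)] 0 ^ i * ![s * t, s * (1 - t)] 1 ^ j)) =
        (s ^ (k + i + j + 1) * jacobi 0 ((2 * k + 1 : ℕ) : ℝ) (n - k) (2 * s - 1)) *
          ∫ t in (0 : ℝ)..1, t ^ 0 * jacobi 0 ((0 : ℕ) : ℝ) k (2 * t - 1) *
            (Polynomial.X ^ i * (1 - Polynomial.X) ^ j : Polynomial ℝ).eval t := by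
      intro s
      rw [← intervalIntegral.integral_const_mul, ← intervalIntegral.integral_const_mul]
      refine intervalIntegral.integral_congr fun t _ => ?_
      simp only [map_mul, eval_homogLegendre_cone, eval_sumJacobi, Matrix.cons_val_zero,
        Matrix.cons_val_one, Nat.cast_zero, Polynomial.eval_mul, Polynomial.eval_pow,
        Polynomial.eval_sub, Polynomial.eval_X, Polynomial.eval_one]
      rw [show s * t + s * (1 - t) = s by ring, mul_pow, mul_pow]
      ring
    simp_rw [e]
    rw [intervalIntegral.integral_mul_const]
    by_cases hlt : i + j < k
    · rw [integral_pow_mul_jacobi_mul_eval_eq_zero, mul_zero]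
      refine lt_of_le_of_lt ?_ hlt
      compute_degree
    · obtain ⟨l, hl⟩ := Nat.exists_eq_add_of_le (not_lt.1 hlt)
      rw [show k + i + j + 1 = 2 * k + 1 + l by lia,
        integral_pow_mul_jacobi_eq_zero (2 * k + 1) (by lia), zero_mul]
  simp_rw [MvPolynomial.eval_eq' _ r, mul_sum, Fin.prod_univ_two]
  rw [integral_finsetSum]
  · refine sum_eq_zero fun d hd => ?_
    have hd' := (MvPolynomial.le_totalDegree hd).trans_lt hr
    rw [Finsupp.sum_fintype _ _ fun _ => rfl, Fin.sum_univ_two] at hd'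
    simp_rw [mul_left_comm _ (MvPolynomial.coeff d r)]
    rw [integral_const_mul, hmono _ _ hd', mul_zero]
  · intro d _
    exact integrableOn_refTriangle ((continuous_mvPolynomial_eval _).mul (by fun_prop))

theorem bBasis_even_comm (n k : ℕ) (x y : ℝ) : bBasis n (2 * k) y x = bBasis n (2 * k) x y := by
  have h : (y - x) / (y + x) = -((x - y) / (x + y)) := by rw [add_comm y x]; ring
  rw [bBasis, bBasis, h, jacobi_zero_zero_neg, (even_two_mul k).neg_one_pow, one_mul, add_comm y x]

/-- Swapping the arguments fixes the first term and exchanges the two rotated ones, because the even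
index makes `bBasis` symmetric. This is what makes nodal values independent of the order of `P` and
`Q`. -/
theorem bRefl_comm (p k : ℕ) (x y : ℝ) : bRefl p k y x = bRefl p k x y := by
  rw [bRefl, bRefl, bBasis_even_comm p k x y, sub_right_comm 1 y x,
    bBasis_even_comm p k (1 - x - y) x, bBasis_even_comm p k y (1 - x - y)]
  ring

theorem two_mul_le_of_lt_dRefl {p k : ℕ} (hk : k < dRefl p) : 2 * k ≤ p := by
  rw [dRefl] at hk
  lia

theorem isOrthPolyRef_bRefl {p k : ℕ} (hk : k < dRefl p) :
    IsOrthPolyRef p fun x => bRefl p k (x 0) (x 1) := by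
  have h := isOrthPolyRef_bBasis (two_mul_le_of_lt_dRefl hk)
  refine ((((h.const_mul 2).sub h.comp_refRotation).sub
    h.comp_refRotation.comp_refRotation).const_mul (1 / 3)).congr fun x _ => ?_
  simp only [refRotation, bRefl, Matrix.cons_val_zero, Matrix.cons_val_one]
  ring_nf

/-- `bRefl` is `bBasis` minus its average over the three rotations. -/
theorem bRefl_add_rotations (p k : ℕ) (x : Fin 2 → ℝ) :
    bRefl p k (x 0) (x 1) + bRefl p k (refRotation x 0) (refRotation x 1) +
      bRefl p k (refRotation (refRotation x) 0) (refRotation (refRotation x) 1) = 0 := by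
  simp only [refRotation, bRefl, Matrix.cons_val_zero, Matrix.cons_val_one]
  ring_nf

end CrouzeixRaviart

/-! ### The rotation argument -/

namespace CrouzeixRaviart

open Finset

/-- A reflection-type combination of the functions `b_{p,k}^refl` vanishes if, along the three edges
of the triangle, an orthogonal polynomial takes its values on the edge `x₁ + x₂ = 1`. -/
theorem sum_bRefl_eq_zero {p : ℕ} (hp : p ≠ 0) (c : ℕ → ℝ) {g : (Fin 2 → ℝ) → ℝ}
    (hg : IsOrthPolyRef p g)
    (h01 : ∀ j ≤ p, g ![(j : ℝ) / p, 1 - (j : ℝ) / p] =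
      ∑ k ∈ range (dRefl p), c k * bRefl p k ((j : ℝ) / p) (1 - (j : ℝ) / p))
    (h0 : ∀ j ≤ p, g ![0, (j : ℝ) / p] =
      ∑ k ∈ range (dRefl p), c k * bRefl p k ((j : ℝ) / p) (1 - (j : ℝ) / p))
    (h1 : ∀ j ≤ p, g ![1 - (j : ℝ) / p, 0] =
      ∑ k ∈ range (dRefl p), c k * bRefl p k ((j : ℝ) / p) (1 - (j : ℝ) / p)) :
    ∀ x ∈ refTriangle, ∑ k ∈ range (dRefl p), c k * bRefl p k (x 0) (x 1) = 0 := by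
  set Q : (Fin 2 → ℝ) → ℝ := fun x => ∑ k ∈ range (dRefl p), c k * bRefl p k (x 0) (x 1) with hQdef
  have hQ : IsOrthPolyRef p Q :=
    IsOrthPolyRef.sum _ fun k hk => (isOrthPolyRef_bRefl (mem_range.1 hk)).const_mul (c k)
  have hrot : ∀ t : ℝ, refRotation ![0, t] = ![t, 1 - t] := fun t => by simp [refRotation]
  have hrot' : ∀ t : ℝ, refRotation ![t, 1 - t] = ![1 - t, 0] := fun t => by simp [refRotation]
  -- The uniqueness result concerns the edge `x₁ = 0`, so the other edges are first rotated onto it;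
  -- `refRotation` sends `(0, t)` to `(t, 1 - t)`.
  have e1 := (hg.comp_refRotation.sub hQ.comp_refRotation).eq_zero_of_nodes hp fun j hj => by
    rw [hrot, h01 j hj, sub_eq_zero]
    rfl
  have e2 := (hg.sub hQ.comp_refRotation).eq_zero_of_nodes hp fun j hj => by
    rw [hrot, h0 j hj, sub_eq_zero]
    rfl
  have e3 := (hg.comp_refRotation.comp_refRotation.sub
      hQ.comp_refRotation).eq_zero_of_nodes hp fun j hj => by
    rw [hrot, hrot', h1 j hj, sub_eq_zero]
    rfl
  have k2 : ∀ x ∈ refTriangle, g x = Q (refRotation x) := fun x hx => sub_eq_zero.1 (e2 x hx)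
  -- On the whole triangle `e1` says `g = Q`, after undoing the rotation, and `e2` says `g = Q ∘
  -- refRotation`.
  have hinv : ∀ x ∈ refTriangle, Q (refRotation x) = Q x := by
    intro x hx
    have hx1 := refRotation_mem_iff.2 hx
    have hx2 := refRotation_mem_iff.2 hx1
    have a1 := sub_eq_zero.1 (e1 _ hx2)
    have a2 := sub_eq_zero.1 (e2 _ hx)
    have a3 := sub_eq_zero.1 (e3 _ hx1)
    simp only [refRotation_refRotation_refRotation] at a1 a3
    rw [← a1, a2]
  intro x hx
  have hx1 := refRotation_mem_iff.2 hx
  have hsum : Q x + Q (refRotation x) + Q (refRotation (refRotation x)) = 0 := by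
    simp only [hQdef, ← sum_add_distrib, ← mul_add, bRefl_add_rotations, mul_zero, sum_const_zero]
  rw [hinv _ hx1, hinv _ hx] at hsum
  change Q x = 0
  linarith

/-! ### Nodal values of the facet functions along the edges of `T` -/

namespace Mesh

variable (G : Mesh) {p : ℕ} {T : Finset E3}

open scoped Classical in
theorem isBary_segment {P Q : E3} (hf : {P, Q} ∈ G.faces) (hPQ : P ≠ Q) {t : ℝ} (h0 : 0 ≤ t)
    (h1 : t ≤ 1) :
    G.IsBary (t • P + (1 - t) • Q) fun v => if v = P then t else if v = Q then 1 - t else 0 := by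
  refine ⟨{P, Q}, hf, fun v _ => ?_, fun v hv => ?_, ?_, ?_⟩
  · dsimp only
    split_ifs <;> linarith
  · simp only [mem_insert, mem_singleton, not_or] at hv
    simp [hv.1, hv.2]
  · simp [sum_pair hPQ, hPQ.symm]
  · simp [sum_pair hPQ, hPQ.symm]

open scoped Classical in
theorem isBary_triangle {V P Q : E3} (hf : {V, P, Q} ∈ G.faces) (hVP : V ≠ P) (hVQ : V ≠ Q)
    (hPQ : P ≠ Q) {s t : ℝ} (hs : 0 ≤ s) (ht : 0 ≤ t) (hst : s + t ≤ 1) :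
    G.IsBary (V + s • (P - V) + t • (Q - V))
      fun v => if v = V then 1 - s - t else if v = P then s else if v = Q then t else 0 := by
  have hV : V ∉ ({P, Q} : Finset E3) := by simp [hVP, hVQ]
  refine ⟨{V, P, Q}, hf, fun v _ => ?_, fun v hv => ?_, ?_, ?_⟩
  · dsimp only
    split_ifs <;> linarith
  · simp only [mem_insert, mem_singleton, not_or] at hv
    simp [hv.1, hv.2.1, hv.2.2]
  · rw [sum_insert hV, sum_pair hPQ]
    simp [hVP.symm, hVQ.symm, hPQ.symm]
  · rw [sum_insert hV, sum_pair hPQ]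
    simp only [if_true, hVP.symm, hVQ.symm, hPQ.symm, if_false]
    module

theorem exists_adjacent (hT : T ∈ G.faces) : ∃ K, K ∈ G.adjacent T := by
  obtain ⟨K, hK, hTK, hc⟩ := G.pure T hT
  exact ⟨K, ⟨hK, hc⟩, hTK⟩

/-- On an edge of `T`, the outer coordinates are the barycentric coordinates on the edge. -/
theorem IsOuterCoord.eq_or_eq {G : Mesh} {P Q : E3} (hT : T ∈ G.faces) (hP : P ∈ T) (hQ : Q ∈ T)
    (hPQ : P ≠ Q) {t : ℝ} (h0 : 0 ≤ t) (h1 : t ≤ 1) {x : ℝ × ℝ}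
    (h : G.IsOuterCoord T (t • P + (1 - t) • Q) x) :
    (x.1 = t ∧ x.2 = 1 - t) ∨ (x.1 = 1 - t ∧ x.2 = t) := by
  classical
  obtain ⟨K, hK, V, hVK, hVT, P', hP', Q', hQ', hPQ', hx1, hx2, hx, hN⟩ := h
  have hVP : V ≠ P' := fun e => hVT (e ▸ hP')
  have hVQ : V ≠ Q' := fun e => hVT (e ▸ hQ')
  have hVP0 : V ≠ P := fun e => hVT (e ▸ hP)
  have hVQ0 : V ≠ Q := fun e => hVT (e ▸ hQ)
  have hf2 : {P, Q} ∈ G.faces := G.down_closed hT (by simp [insert_subset_iff, hP, hQ]) (by simp)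
  have hf3 : {V, P', Q'} ∈ G.faces := G.down_closed hK.1.1
    (by simp [insert_subset_iff, hVK, hK.2 hP', hK.2 hQ']) (by simp)
  have b1 := G.isBary_segment hf2 hPQ h0 h1
  have b2 := G.isBary_triangle hf3 hVP hVQ hPQ' hx1 hx2 hx
  rw [← hN] at b2
  -- Both expansions describe one point. At `V` this forces `x.1 + x.2 = 1`; comparison at `P'` and
  -- `Q'` then settles each way `{P', Q'}` can meet `{P, Q}`. If only one vertex is shared, the
  -- point is that vertex or there is a contradiction.
  have e := b1.unique b2
  have eV := congr_fun e V
  have eP := congr_fun e P'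
  have eQ := congr_fun e Q'
  simp only [hVP0, hVQ0, hVP.symm, hVQ.symm, hPQ'.symm, if_true, if_false] at eV eP eQ
  by_cases c1 : P' = P
  · have : Q' ≠ P := fun h => hPQ' (c1.trans h.symm)
    rw [if_pos c1] at eP
    left
    constructor <;> linarith
  · rw [if_neg c1] at eP
    by_cases c2 : P' = Q
    · rw [if_pos c2] at eP
      right
      constructor <;> linarith
    · rw [if_neg c2] at eP
      by_cases c3 : Q' = P
      · rw [if_pos c3] at eQ
        right
        constructor <;> linarith
      · rw [if_neg c3] at eQ
        by_cases c4 : Q' = Q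
        · rw [if_pos c4] at eQ
          left
          constructor <;> linarith
        · rw [if_neg c4] at eQ
          linarith

/-- A point of an edge of `T` has outer coordinates `(t, 1 - t)`, with weight zero at the opposite
vertex. The coordinates picked by `choose` may be swapped, and `bRefl_comm` absorbs this. -/
theorem nodalValue_segment (hT : T ∈ G.faces) (hcard : T.card = 3) {P Q : E3} (hP : P ∈ T)
    (hQ : Q ∈ T) (hPQ : P ≠ Q) {t : ℝ} (h0 : 0 ≤ t) (h1 : t ≤ 1) (k : ℕ) :
    G.nodalValue p k T (t • P + (1 - t) • Q) = bRefl p k t (1 - t) := by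
  have hex : ∃ x, G.IsOuterCoord T (t • P + (1 - t) • Q) x := by
    obtain ⟨K, hK⟩ := G.exists_adjacent hT
    obtain ⟨V, hVK, hVT⟩ := exists_mem_notMem_of_card_lt_card
      (show T.card < K.card by rw [hcard, hK.1.2]; norm_num)
    refine ⟨(t, 1 - t), K, hK, V, hVK, hVT, P, hP, Q, hQ, hPQ, h0, by linarith, by simp, ?_⟩
    module
  rw [nodalValue, dif_pos hex]
  rcases hex.choose_spec.eq_or_eq hT hP hQ hPQ h0 h1 with ⟨e1, e2⟩ | ⟨e1, e2⟩
  · rw [e1, e2]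
  · rw [e1, e2, bRefl_comm]

theorem segment_mem_nodes (hp : p ≠ 0) (hT : T ∈ G.faces) {P Q : E3} (hP : P ∈ T) (hQ : Q ∈ T)
    {j : ℕ} (hj : j ≤ p) :
    ((j : ℝ) / p) • P + (1 - (j : ℝ) / p) • Q ∈ G.nodes p := by
  classical
  obtain ⟨K, hK⟩ := G.exists_adjacent hT
  have hp' : (p : ℝ) ≠ 0 := Nat.cast_ne_zero.2 hp
  have hPK := hK.2 hP
  have hQK := hK.2 hQ
  simp only [nodes, mem_biUnion, mem_filter, Set.Finite.mem_toFinset, mem_image,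
    mem_finsuppAntidiag]
  refine ⟨K, hK.1, Finsupp.single P j + Finsupp.single Q (p - j), ⟨?_, ?_⟩, ?_⟩
  · simp only [Finsupp.coe_add, Pi.add_apply, sum_add_distrib, Finsupp.single_apply, sum_ite_eq,
      hPK, hQK, if_true]
    lia
  · intro v hv
    by_contra hvK
    have h1 : P ≠ v := fun e => hvK (e ▸ hPK)
    have h2 : Q ≠ v := fun e => hvK (e ▸ hQK)
    simp [h1, h2] at hv
  · simp only [Finsupp.add_apply, Nat.cast_add, add_div, add_smul, sum_add_distrib]
    congr 1
    · rw [sum_eq_single_of_mem P hPK fun v _ hv => by simp [hv.symm]]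
      simp
    · rw [sum_eq_single_of_mem Q hQK fun v _ hv => by simp [hv.symm]]
      rw [Finsupp.single_eq_same, Nat.cast_sub hj, sub_div, div_self hp']

theorem convexHull_subset_patch (hT : T ∈ G.faces) : convexHull ℝ (T : Set E3) ⊆ G.patch T := by
  obtain ⟨K, hK⟩ := G.exists_adjacent hT
  exact (convexHull_mono (Finset.coe_subset.2 hK.2)).trans
    (Set.subset_biUnion_of_mem (u := fun K : Finset E3 => convexHull ℝ (K : Set E3)) hK)

theorem facetBasis_node (hp : p ≠ 0) {N : E3} (hN : N ∈ G.nodes p) (hNT : N ∈ G.patch T) (k : ℕ) :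
    G.facetBasis p k T N = G.nodalValue p k T N := by
  classical
  rw [facetBasis, Set.indicator_of_mem hNT, sum_eq_single_of_mem N hN fun N' hN' hne => by
    rw [G.lagrange_node hp hN' hN, if_neg hne, mul_zero]]
  rw [G.lagrange_node hp hN hN, if_pos rfl, mul_one]

theorem facetBasis_segment (hp : p ≠ 0) (hT : T ∈ G.faces) (hcard : T.card = 3) {P Q : E3}
    (hP : P ∈ T) (hQ : Q ∈ T) (hPQ : P ≠ Q) {j : ℕ} (hj : j ≤ p) (k : ℕ) :
    G.facetBasis p k T (((j : ℝ) / p) • P + (1 - (j : ℝ) / p) • Q) =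
      bRefl p k ((j : ℝ) / p) (1 - (j : ℝ) / p) := by
  have hp' : (0 : ℝ) < p := by exact_mod_cast Nat.pos_of_ne_zero hp
  have h0 : (0 : ℝ) ≤ (j : ℝ) / p := by positivity
  have h1 : (j : ℝ) / p ≤ 1 := by
    rw [div_le_one hp']
    exact_mod_cast hj
  rw [G.facetBasis_node hp (G.segment_mem_nodes hp hT hP hQ hj),
    G.nodalValue_segment hT hcard hP hQ hPQ h0 h1]
  exact G.convexHull_subset_patch hT (convex_convexHull ℝ _ (subset_convexHull ℝ _ hP)
    (subset_convexHull ℝ _ hQ) h0 (by linarith) (by ring))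

theorem exists_eq_sum_of_mem_facetSpace {u : E3 → ℝ} (hu : u ∈ G.facetSpace p T) :
    ∃ c : ℕ → ℝ, u = ∑ k ∈ range (dRefl p), c k • G.facetBasis p k T := by
  induction hu using Submodule.span_induction with
  | mem f hf =>
    obtain ⟨k, hk, rfl⟩ := hf
    refine ⟨Pi.single k 1, ?_⟩
    rw [sum_eq_single_of_mem k (mem_range.2 hk) fun i _ hi => by simp [Pi.single_eq_of_ne hi]]
    simp
  | zero => exact ⟨0, by simp⟩
  | add f g _ _ hf hg =>
    obtain ⟨c, rfl⟩ := hf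
    obtain ⟨d, rfl⟩ := hg
    exact ⟨c + d, by simp [add_smul, sum_add_distrib]⟩
  | smul a f _ hf =>
    obtain ⟨c, rfl⟩ := hf
    exact ⟨a • c, by simp [smul_sum, mul_smul]⟩

/-- Each nodal value of the combination is either a value of the vanishing polynomial on the
reference triangle or zero by default, so all Lagrange coefficients vanish. -/
theorem sum_smul_facetBasis_eq_zero (c : ℕ → ℝ)
    (h : ∀ x ∈ refTriangle, ∑ k ∈ range (dRefl p), c k * bRefl p k (x 0) (x 1) = 0) :
    ∑ k ∈ range (dRefl p), c k • G.facetBasis p k T = 0 := by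
  have hnodal : ∀ N, ∑ k ∈ range (dRefl p), c k * G.nodalValue p k T N = 0 := by
    intro N
    by_cases hex : ∃ x, G.IsOuterCoord T N x
    · obtain ⟨K, -, V, -, -, P, -, Q, -, -, h0, h1, h2, -⟩ := hex.choose_spec
      simp only [nodalValue, dif_pos hex]
      exact h ![hex.choose.1, hex.choose.2] ⟨h0, h1, h2⟩
    · simp only [nodalValue, dif_neg hex, mul_zero, sum_const_zero]
  funext x
  simp only [Finset.sum_apply, Pi.smul_apply, smul_eq_mul, Pi.zero_apply, facetBasis]
  by_cases hx : x ∈ G.patch T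
  · simp only [Set.indicator_of_mem hx, mul_sum]
    rw [sum_comm]
    refine sum_eq_zero fun N _ => ?_
    simp_rw [← mul_assoc]
    rw [← sum_mul, hnodal, zero_mul]
  · simp only [Set.indicator_of_notMem hx, mul_zero, sum_const_zero]

end Mesh

end CrouzeixRaviart

/-! ### Conclusion -/

theorem mainTheorem9 (G : CrouzeixRaviart.Mesh) (p : ℕ) (T : Finset CrouzeixRaviart.E3)
    (hT : T ∈ G.innerFacets) (u : CrouzeixRaviart.E3 → ℝ) (hu : u ∈ G.facetSpace p T)
    (horth : CrouzeixRaviart.IsOrthPolyOn p T u) : u = 0 := by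
  classical
  obtain ⟨c, rfl⟩ := G.exists_eq_sum_of_mem_facetSpace hu
  rcases Nat.eq_zero_or_pos p with rfl | hpos
  -- For `p = 0`, `dRefl 0 = 2 / 3 = 0` in natural division, so the sum is empty.
  · simp [CrouzeixRaviart.dRefl]
  have hp := hpos.ne'
  obtain ⟨hTf, hcard, -⟩ := hT
  obtain ⟨A, B, C, hABC, horth⟩ := horth
  have hABC' : T = {A, B, C} := by
    rw [← Finset.coe_inj, hABC]
    simp
  obtain ⟨hAB, hAC, hBC⟩ : A ≠ B ∧ A ≠ C ∧ B ≠ C := by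
    rw [← Finset.card_triple_eq_three_iff, ← hABC', hcard]
  have hA : A ∈ T := by simp [hABC']
  have hB : B ∈ T := by simp [hABC']
  have hC : C ∈ T := by simp [hABC']
  have key : ∀ P ∈ T, ∀ Q ∈ T, P ≠ Q → ∀ j ≤ p, ∀ x, x = ((j : ℝ) / p) • P + (1 - (j : ℝ) / p) • Q →
      (∑ k ∈ Finset.range (CrouzeixRaviart.dRefl p), c k • G.facetBasis p k T) x =
        ∑ k ∈ Finset.range (CrouzeixRaviart.dRefl p),
          c k * CrouzeixRaviart.bRefl p k ((j : ℝ) / p) (1 - (j : ℝ) / p) := by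
    rintro P hP Q hQ hPQ j hj x rfl
    simp only [Finset.sum_apply, Pi.smul_apply, smul_eq_mul,
      G.facetBasis_segment hp hTf hcard hP hQ hPQ hj]
  -- The edges are traversed cyclically as `(B, C)`, `(C, A)`, `(A, B)`: in the chart based at `A`
  -- these are `x₁ + x₂ = 1`, `x₁ = 0` and `x₂ = 0`.
  refine G.sum_smul_facetBasis_eq_zero c (CrouzeixRaviart.sum_bRefl_eq_zero hp c horth
    (fun j hj => key B hB C hC hBC j hj _ ?_) (fun j hj => key C hC A hA hAC.symm j hj _ ?_)
    fun j hj => key A hA B hB hAB j hj _ ?_) <;>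
  simp only [Matrix.cons_val_zero, Matrix.cons_val_one] <;> module
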